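/- Let $P$ and $Q$ be probability distributions on finite sets $\mathcal X$ and $\mathcal Y$, let $H$ denote the Shannon entropy in bits (logarithms to base $2$), and assume $H(Q)>0$. Write $P^n$ for the $n$-fold i.i.d. distribution of $P$ and $F(Q',Q'')=\sum_{y}\sqrt{Q'(y)}\sqrt{Q''(y)}$ for the fidelity. For distributions $A,B$ on finite sets, $A\prec B$ means that $\sum_{i\le l}A^{\downarrow}_i\le\sum_{i\le l}B^{\downarrow}_i$ for all $l$, where $\downarrow$ sorts the probabilities in decreasing order (continued by zeros). For distributions $A$ on a finite set $\mathcal A$ and $B$ on a finite set $\mathcal B$ and $N\in\{0,1,2,\dots\}$, define the maximal fidelities via a storage of $N$ bits $$F^{\mathcal D}(A\to B|N)=\sup\{F((W'\circ W)(A),B)\;:\;W:\mathcal A\to\{0,1\}^N,\ W':\{0,1\}^N\to\mathcal B\},$$ where $W(A)$ is the image distribution of $A$ under $W$, and $$F^{\mathcal M}(A\to B|N)=\sup\{F(A'',B)\;:\;A\prec A'\prec A'',\ A'\text{ a distribution on }\{0,1\}^N,\ A''\text{ a distribution on }\mathcal B\}.$$ For $i\in\{\mathcal D,\mathcal M\}$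 and $\nu\in(0,1)$ let $\mathcal R^{1,i}_{P,Q}(\nu)$ be the set of pairs $(s_1,t_1)$ of positive real numbers for which there are sequences of non-negative integers $S_n=s_1n+o(n)$ and $T_n=t_1n+o(n)$ with $$\liminf_{n\to\infty}F^{i}(P^n\to Q^{T_n}|S_n)\ge\nu .$$ Then, for every $\nu\in(0,1)$, $$\mathcal R^{1,\mathcal D}_{P,Q}(\nu)=\mathcal R^{1,\mathcal M}_{P,Q}(\nu)=\left\{(s_1,t_1)\;:\;s_1>0,\ 0<t_1\le\frac{\min\{H(P),s_1\}}{H(Q)}\right\}.$$ In particular, these regions do not depend on $\nu$. -/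

import Mathlib

open Filter Topology Asymptotics

noncomputable section

namespace RNC

/-- The image distribution `W(P)(y) = ∑_{x ∈ W⁻¹(y)} P(x)`. -/
def pushforward {X Y : Type*} [Fintype X] (W : X → Y) (P : X → ℝ) : Y → ℝ :=
  open Classical in fun y => ∑ x with W x = y, P x

/-- The fidelity (Bhattacharyya coefficient) `F(Q, Q') = ∑_y √Q(y) √Q'(y)`. -/
def fidelity {Y : Type*} [Fintype Y] (Q Q' : Y → ℝ) : ℝ :=
  ∑ y, √(Q y) * √(Q' y)

/-- The `n`-fold i.i.d. distribution of `P`, on `X ^ n`. -/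
def iid {X : Type*} (P : X → ℝ) (n : ℕ) : (Fin n → X) → ℝ :=
  fun x => ∏ i, P (x i)

/-- The Shannon entropy, in bits. -/
def entropy {X : Type*} [Fintype X] (P : X → ℝ) : ℝ :=
  -∑ x, P x * Real.logb 2 (P x)

/-- The values of `P` sorted in decreasing order, indexed from `0` and continued by zeros. -/
def sortedDesc {X : Type*} [Fintype X] (P : X → ℝ) (i : ℕ) : ℝ :=
  ((Finset.univ.val.map P).sort (· ≥ ·)).getD i 0

/-- `P ≺ Q`: `P` is majorized by `Q` (the underlying sets may be different). -/
def Majorized {X Y : Type*} [Fintype X] [Fintype Y] (P : X → ℝ) (Q : Y → ℝ) : Prop :=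
  ∀ l : ℕ, ∑ i ∈ Finset.range l, sortedDesc P i ≤ ∑ i ∈ Finset.range l, sortedDesc Q i

/-- The storage of `N` bits. -/
abbrev Storage (N : ℕ) : Type := Fin N → Bool

/-- The maximal fidelity from `P` to `Q` by deterministic conversions via a storage of `N` bits. -/
def fidelityD {X Y : Type*} [Fintype X] [Fintype Y] (P : X → ℝ) (Q : Y → ℝ) (N : ℕ) : ℝ :=
  sSup {f : ℝ | ∃ (W : X → Storage N) (W' : Storage N → Y),
    f = fidelity (pushforward (W' ∘ W) P) Q}

/-- The maximal fidelity from `P` to `Q` by majorization conversions via a storage of `N` bits. -/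
def fidelityM {X Y : Type*} [Fintype X] [Fintype Y] (P : X → ℝ) (Q : Y → ℝ) (N : ℕ) : ℝ :=
  sSup {f : ℝ | ∃ P' ∈ stdSimplex ℝ (Storage N), ∃ P'' ∈ stdSimplex ℝ Y,
    Majorized P P' ∧ Majorized P' P'' ∧ f = fidelity P'' Q}

/-- `ν`-achievability of a sequence `(S_n, T_n)` for deterministic conversions. -/
def SeqAchievableD {X Y : Type*} [Fintype X] [Fintype Y] (P : X → ℝ) (Q : Y → ℝ) (ν : ℝ)
    (S T : ℕ → ℕ) : Prop :=
  ν ≤ liminf (fun n => fidelityD (iid P n) (iid Q (T n)) (S n)) atTop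

/-- `ν`-achievability of a sequence `(S_n, T_n)` for majorization conversions. -/
def SeqAchievableM {X Y : Type*} [Fintype X] [Fintype Y] (P : X → ℝ) (Q : Y → ℝ) (ν : ℝ)
    (S T : ℕ → ℕ) : Prop :=
  ν ≤ liminf (fun n => fidelityM (iid P n) (iid Q (T n)) (S n)) atTop

/-- `u_n = r n + o(n)`. -/
def HasRate (u : ℕ → ℕ) (r : ℝ) : Prop :=
  (fun n : ℕ => (u n : ℝ) - r * n) =o[atTop] (fun n : ℕ => (n : ℝ))

/-- The first-order `ν`-achievable rate region for deterministic conversions: the pairs of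
positive rates `(s₁, t₁)` for which a sequence `(s₁ n + o(n), t₁ n + o(n))` is `ν`-achievable. -/
def regionD {X Y : Type*} [Fintype X] [Fintype Y] (P : X → ℝ) (Q : Y → ℝ) (ν : ℝ) :
    Set (ℝ × ℝ) :=
  {r | 0 < r.1 ∧ 0 < r.2 ∧
    ∃ S T : ℕ → ℕ, HasRate S r.1 ∧ HasRate T r.2 ∧ SeqAchievableD P Q ν S T}

/-- The first-order `ν`-achievable rate region for majorization conversions. -/
def regionM {X Y : Type*} [Fintype X] [Fintype Y] (P : X → ℝ) (Q : Y → ℝ) (ν : ℝ) :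
    Set (ℝ × ℝ) :=
  {r | 0 < r.1 ∧ 0 < r.2 ∧
    ∃ S T : ℕ → ℕ, HasRate S r.1 ∧ HasRate T r.2 ∧ SeqAchievableM P Q ν S T}

end RNC

end

noncomputable section

namespace RNC

/-! Outside the region every fidelity tends to 0. On it, boundary included, suitable sequences drive
the fidelity to 1. This is why ν plays no role. Converse (`tendsto_fidelityM_zero`): almost all of
P^n sits on about 2^(nH(P)) sequences, and a distribution on the storage sits on 2^(S_n) points.
Majorization only concentrates mass, so A'' puts almost all its mass on a set of size about
2^(n·min(H(P), s₁)). If t₁H(Q) exceeds the minimum, Q^(T_n) gives every set of that size vanishing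
mass, and `fidelityM_le` makes the fidelity vanish. Achievability
(`exists_rates_tendsto_fidelityD_one`): the typical atoms of P^n are much smaller than those of
Q^(T_n) once T_n is lowered by O(n^(3/4)), so packing them greedily into the likely sequences of
Q^(T_n) reproduces it almost exactly (`min_le_fidelityD`). Since an image distribution majorizes its
source, `fidelityD` is at most `fidelityM`; the converse for M and achievability for D therefore
settle both regions. -/

lemma pushforward_nonneg {X Y : Type*} [Fintype X] (W : X → Y) {P : X → ℝ} (hP : ∀ x, 0 ≤ P x) (y : Y) :
    0 ≤ pushforward W P y :=
  Finset.sum_nonneg fun x _ => hP x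

lemma sum_pushforward {X Y : Type*} [Fintype X] [DecidableEq Y] (W : X → Y) (P : X → ℝ) (t : Finset Y) :
    ∑ y ∈ t, pushforward W P y = ∑ x with W x ∈ t, P x := by
  classical
  rw [← Finset.sum_fiberwise_of_maps_to (s := Finset.univ.filter fun x => W x ∈ t) (t := t) (g := W)
    (fun x hx => (Finset.mem_filter.mp hx).2)]
  refine Finset.sum_congr rfl fun y hy => ?_
  unfold pushforward
  refine Finset.sum_congr ?_ fun _ _ => rfl
  ext x
  simp only [Finset.mem_filter, Finset.mem_univ, true_and]
  exact ⟨fun h => ⟨h ▸ hy, h⟩, fun h => h.2⟩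

/-! ### Majorization through the masses of finite sets. -/

section Majorization

variable {X Y : Type*} [Fintype X] [Fintype Y]

lemma sum_range_getD_eq_sum_take (L : List ℝ) (l : ℕ) :
    ∑ i ∈ Finset.range l, L.getD i 0 = (L.take l).sum := by
  induction l generalizing L with
  | zero => simp
  | succ l ih =>
    cases L with
    | nil => simp
    | cons a L =>
      rw [Finset.sum_range_succ']
      simp only [List.getD_cons_succ, List.getD_cons_zero, List.take_succ_cons, List.sum_cons]
      rw [ih, add_comm]

lemma sum_take_succ_le {a : ℝ} {L : List ℝ} (h : ∀ b ∈ L, b ≤ a) (ha : 0 ≤ a) (l : ℕ) :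
    (L.take (l + 1)).sum ≤ a + (L.take l).sum := by
  rw [List.take_add_one, List.sum_append]
  rcases hl : L[l]? with _ | b
  · simpa using ha
  · have := h b (List.mem_of_getElem? hl)
    simp only [Option.toList_some, List.sum_cons, List.sum_nil]
    linarith

lemma sum_le_sum_take_of_sublist {K L : List ℝ} (hKL : K.Sublist L)
    (hL : L.Pairwise (· ≥ ·)) (h0 : ∀ a ∈ L, 0 ≤ a) {l : ℕ} (hl : K.length ≤ l) :
    K.sum ≤ (L.take l).sum := by
  induction hKL generalizing l with
  | slnil => simp
  | @cons K L a h ih =>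
    rw [List.pairwise_cons] at hL
    have h0' : ∀ b ∈ L, 0 ≤ b := fun b hb => h0 b (List.mem_cons_of_mem _ hb)
    cases l with
    | zero => simp [List.length_eq_zero_iff.mp (Nat.le_zero.mp hl)]
    | succ l =>
      simp only [List.take_succ_cons, List.sum_cons]
      exact (ih hL.2 h0' hl).trans (sum_take_succ_le hL.1 (h0 a List.mem_cons_self) l)
  | @cons_cons K L a h ih =>
    rw [List.pairwise_cons] at hL
    have h0' : ∀ b ∈ L, 0 ≤ b := fun b hb => h0 b (List.mem_cons_of_mem _ hb)
    cases l with
    | zero => simp at hl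
    | succ l =>
      simp only [List.take_succ_cons, List.sum_cons]
      have := ih hL.2 h0' (Nat.le_of_succ_le_succ hl)
      linarith

/-- With `exists_sum_sortedDesc_eq`, this identifies the partial sums of the sorted values as the
largest mass of a set of at most l points, so that sorting can be forgotten afterwards. -/
lemma sum_le_sum_sortedDesc {P : X → ℝ} (hP : ∀ x, 0 ≤ P x) (s : Finset X) {l : ℕ}
    (hl : s.card ≤ l) : ∑ x ∈ s, P x ≤ ∑ i ∈ Finset.range l, sortedDesc P i := by
  unfold sortedDesc
  rw [sum_range_getD_eq_sum_take]
  have hle : s.val.map P ≤ ((Finset.univ.val.map P).sort (· ≥ ·) : Multiset ℝ) := by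
    rw [Multiset.sort_eq]
    exact Multiset.map_le_map (Finset.val_le_iff.mpr (Finset.subset_univ s))
  obtain ⟨K, hK⟩ : ∃ K : List ℝ, (K : Multiset ℝ) = s.val.map P := ⟨_, Multiset.coe_toList _⟩
  rw [← hK, Multiset.coe_le] at hle
  obtain ⟨K', hperm, hsub⟩ := hle
  have hsum : ∑ x ∈ s, P x = K'.sum := by
    rw [hperm.sum_eq, ← Multiset.sum_coe, hK]; rfl
  rw [hsum]
  refine sum_le_sum_take_of_sublist hsub (Multiset.pairwise_sort _ _) ?_ ?_
  · intro a ha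
    rw [Multiset.mem_sort] at ha
    obtain ⟨x, -, rfl⟩ := Multiset.mem_map.mp ha
    exact hP x
  · rw [hperm.length_eq, ← Multiset.coe_card, hK, Multiset.card_map]
    exact hl

lemma exists_sum_sortedDesc_eq (P : X → ℝ) (l : ℕ) :
    ∃ s : Finset X, s.card ≤ l ∧ ∑ i ∈ Finset.range l, sortedDesc P i = ∑ x ∈ s, P x := by
  classical
  set K := (Finset.univ : Finset X).toList.mergeSort (fun a b => decide (P b ≤ P a)) with hKdef
  have hperm : K.Perm (Finset.univ : Finset X).toList := List.mergeSort_perm _ _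
  have hsorted : (K.map P).Pairwise (· ≥ ·) := by
    rw [List.pairwise_map]
    have := List.pairwise_mergeSort (le := fun a b => decide (P b ≤ P a))
      (fun a b c => by simpa using fun h1 h2 => le_trans h2 h1)
      (fun a b => by simpa using le_total _ _) (Finset.univ : Finset X).toList
    exact this.imp (fun h => by simpa using h)
  have hK : (Finset.univ.val.map P).sort (· ≥ ·) = K.map P := by
    refine List.Perm.eq_of_pairwise' (Multiset.pairwise_sort _ _) hsorted ?_
    rw [← Multiset.coe_eq_coe, Multiset.sort_eq, ← Multiset.map_coe,
      Multiset.coe_eq_coe.mpr hperm, Finset.coe_toList]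
  have hnodup : (K.take l).Nodup :=
    (hperm.nodup_iff.mpr (Finset.nodup_toList _)).sublist (List.take_sublist _ _)
  refine ⟨(K.take l).toFinset, (List.toFinset_card_le _).trans (List.length_take_le _ _), ?_⟩
  unfold sortedDesc
  rw [sum_range_getD_eq_sum_take, hK, ← List.map_take, List.sum_toFinset _ hnodup]

lemma Majorized.exists_sum_le {A : X → ℝ} {B : Y → ℝ} (h : Majorized A B)
    (hA : ∀ x, 0 ≤ A x) (s : Finset X) :
    ∃ b : Finset Y, b.card ≤ s.card ∧ ∑ x ∈ s, A x ≤ ∑ y ∈ b, B y := by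
  obtain ⟨b, hb, hsum⟩ := exists_sum_sortedDesc_eq B s.card
  exact ⟨b, hb, (sum_le_sum_sortedDesc hA s le_rfl).trans ((h _).trans hsum.le)⟩

lemma Majorized.trans {Z : Type*} [Fintype Z] {A : X → ℝ} {B : Y → ℝ} {C : Z → ℝ}
    (h₁ : Majorized A B) (h₂ : Majorized B C) : Majorized A C :=
  fun l => (h₁ l).trans (h₂ l)

lemma pushforward_mem_stdSimplex (W : X → Y) {P : X → ℝ} (hP : P ∈ stdSimplex ℝ X) :
    pushforward W P ∈ stdSimplex ℝ Y := by
  classical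
  refine ⟨pushforward_nonneg W hP.1, ?_⟩
  rw [sum_pushforward]
  simpa using hP.2

lemma pushforward_comp {Z : Type*} [Fintype Z] (W : X → Y) (W' : Y → Z) (P : X → ℝ) :
    pushforward (W' ∘ W) P = pushforward W' (pushforward W P) := by
  classical
  ext z
  have := sum_pushforward W P (Finset.univ.filter fun y => W' y = z)
  unfold pushforward at this ⊢
  rw [Finset.sum_congr (by congr) (fun _ _ => rfl), this]
  exact Finset.sum_congr (by ext; simp) fun _ _ => rfl

/-- The image under W of an optimal l-point set has at most l points, and its preimage contains the
original set. -/
lemma majorized_pushforward (W : X → Y) {P : X → ℝ} (hP : ∀ x, 0 ≤ P x) :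
    Majorized P (pushforward W P) := by
  classical
  intro l
  obtain ⟨s, hs, hsum⟩ := exists_sum_sortedDesc_eq P l
  rw [hsum]
  refine le_trans ?_ (sum_le_sum_sortedDesc (pushforward_nonneg W hP) (s.image W)
    (Finset.card_image_le.trans hs))
  rw [sum_pushforward]
  refine Finset.sum_le_sum_of_subset_of_nonneg (fun x hx => ?_) fun x _ _ => hP x
  simpa using ⟨x, hx, rfl⟩

end Majorization

/-! ### Greedy packing of atoms. -/

/-- Greedy allocation of the atoms in `s` to the points of `t`: either all of `s` is allocated
without exceeding the target `Q`, or every target is filled up to an error of one atom. -/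
lemma exists_greedy_allocation {X Y : Type*} [DecidableEq X] [DecidableEq Y] {P : X → ℝ} {m : ℝ}
    (hP : ∀ x, 0 ≤ P x) {Q : Y → ℝ} (hQ : ∀ y, 0 ≤ Q y) {t : Finset Y} (ht : t.Nonempty)
    (s : Finset X) (hs : ∀ x ∈ s, P x ≤ m) :
    ∃ f : X → Y, (∀ x, f x ∈ t) ∧
      ((∀ y ∈ t, ∑ x ∈ s with f x = y, P x ≤ Q y) ∨
        (∀ y ∈ t, Q y - m ≤ ∑ x ∈ s with f x = y, P x)) := by
  induction s using Finset.induction_on with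
  | empty =>
    obtain ⟨y, hy⟩ := ht
    exact ⟨fun _ => y, fun _ => hy, Or.inl fun y _ => by simpa using hQ y⟩
  | insert a s ha ih =>
    obtain ⟨f, hft, hf⟩ := ih fun x hx => hs x (Finset.mem_insert_of_mem hx)
    by_cases hfull : ∀ y ∈ t, Q y - m ≤ ∑ x ∈ s with f x = y, P x
    · refine ⟨f, hft, Or.inr fun y hy => (hfull y hy).trans ?_⟩
      exact Finset.sum_le_sum_of_subset_of_nonneg
        (Finset.filter_subset_filter _ (Finset.subset_insert _ _)) fun x _ _ => hP x
    -- Some target z still lacks more than m, so it can take the atom a, of size at most m, without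
    -- overflowing.
    · have hle := hf.resolve_right hfull
      push Not at hfull
      obtain ⟨z, hz, hlt⟩ := hfull
      have hcongr : ∀ y, ∑ x ∈ s with Function.update f a z x = y, P x
          = ∑ x ∈ s with f x = y, P x := fun y =>
        Finset.sum_congr (Finset.filter_congr fun x hx => by
          rw [Function.update_of_ne (ne_of_mem_of_not_mem hx ha)]) fun _ _ => rfl
      refine ⟨Function.update f a z, fun x => ?_, Or.inl fun y hy => ?_⟩
      · by_cases hx : x = a
        · subst hx; simpa using hz
        · rw [Function.update_of_ne hx]; exact hft x
      · rw [Finset.filter_insert, Function.update_self]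
        split_ifs with hzy
        · subst hzy
          rw [Finset.sum_insert (by simp [ha]), hcongr]
          have := hs a (Finset.mem_insert_self _ _)
          linarith
        · rw [hcongr]
          exact hle y hy

/-! ### Bounds on the maximal fidelities for a single pair of distributions. -/

section Fidelity

variable {X Y : Type*} [Fintype X] [Fintype Y]

lemma fidelity_nonneg (A B : Y → ℝ) : 0 ≤ fidelity A B :=
  Finset.sum_nonneg fun _ _ => by positivity

lemma fidelity_le_one {A B : Y → ℝ} (hA : A ∈ stdSimplex ℝ Y) (hB : B ∈ stdSimplex ℝ Y) :
    fidelity A B ≤ 1 := by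
  have := Real.sum_sqrt_mul_sqrt_le Finset.univ hA.1 hB.1
  rw [hA.2, hB.2] at this
  simpa [fidelity] using this

/-- Cauchy–Schwarz on b and on its complement separately; in each product one factor is dropped
because it is at most 1. -/
lemma fidelity_le_sqrt_add_sqrt {A B : Y → ℝ} (hA : A ∈ stdSimplex ℝ Y)
    (hB : B ∈ stdSimplex ℝ Y) (b : Finset Y) :
    fidelity A B ≤ √(∑ y ∈ b, B y) + √(1 - ∑ y ∈ b, A y) := by
  classical
  have le_one : ∀ {C : Y → ℝ}, C ∈ stdSimplex ℝ Y → ∀ c : Finset Y, ∑ y ∈ c, C y ≤ 1 :=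
    fun hC c => (Finset.sum_le_univ_sum_of_nonneg hC.1).trans hC.2.le
  have hcompl : ∑ y ∈ bᶜ, A y = 1 - ∑ y ∈ b, A y := by
    rw [← hA.2, ← Finset.sum_add_sum_compl b]; ring
  rw [fidelity, ← Finset.sum_add_sum_compl b, ← hcompl]
  have h1 := Real.sum_sqrt_mul_sqrt_le b hA.1 hB.1
  have h2 := Real.sum_sqrt_mul_sqrt_le bᶜ hA.1 hB.1
  have h3 : √(∑ y ∈ b, A y) ≤ 1 := Real.sqrt_le_one.mpr (le_one hA b)
  have h4 : √(∑ y ∈ bᶜ, B y) ≤ 1 := Real.sqrt_le_one.mpr (le_one hB bᶜ)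
  refine add_le_add (h1.trans ?_) (h2.trans ?_)
  · exact mul_le_of_le_one_left (Real.sqrt_nonneg _) h3
  · exact mul_le_of_le_one_right (Real.sqrt_nonneg _) h4

lemma sum_min_le_fidelity {A B : Y → ℝ} (hA : ∀ y, 0 ≤ A y) (hB : ∀ y, 0 ≤ B y) (t : Finset Y) :
    ∑ y ∈ t, min (A y) (B y) ≤ fidelity A B := by
  refine le_trans (Finset.sum_le_sum (g := fun y => √(A y) * √(B y)) fun y _ => ?_)
    (Finset.sum_le_univ_sum_of_nonneg fun y => by positivity)
  have h0 : 0 ≤ min (A y) (B y) := le_min (hA y) (hB y)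
  calc min (A y) (B y) = √(min (A y) (B y)) * √(min (A y) (B y)) := (Real.mul_self_sqrt h0).symm
    _ ≤ √(A y) * √(B y) := by
      gcongr
      · exact min_le_left _ _
      · exact min_le_right _ _

lemma bddAbove_fidelityD {P : X → ℝ} {Q : Y → ℝ} (hP : P ∈ stdSimplex ℝ X)
    (hQ : Q ∈ stdSimplex ℝ Y) (N : ℕ) :
    BddAbove {f : ℝ | ∃ (W : X → Storage N) (W' : Storage N → Y),
      f = fidelity (pushforward (W' ∘ W) P) Q} :=
  ⟨1, by
    rintro f ⟨W, W', rfl⟩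
    exact fidelity_le_one (pushforward_mem_stdSimplex _ hP) hQ⟩

lemma fidelityD_nonneg (P : X → ℝ) (Q : Y → ℝ) (N : ℕ) : 0 ≤ fidelityD P Q N :=
  Real.sSup_nonneg (by rintro f ⟨W, W', rfl⟩; exact fidelity_nonneg _ _)

lemma fidelityM_nonneg (P : X → ℝ) (Q : Y → ℝ) (N : ℕ) : 0 ≤ fidelityM P Q N :=
  Real.sSup_nonneg (by rintro f ⟨_, _, _, _, _, _, rfl⟩; exact fidelity_nonneg _ _)

lemma fidelityM_le_one (P : X → ℝ) {Q : Y → ℝ} (hQ : Q ∈ stdSimplex ℝ Y) (N : ℕ) :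
    fidelityM P Q N ≤ 1 :=
  Real.sSup_le (by rintro f ⟨_, _, _, h, _, _, rfl⟩; exact fidelity_le_one h hQ) zero_le_one

lemma fidelityD_le_fidelityM {P : X → ℝ} {Q : Y → ℝ} (hP : P ∈ stdSimplex ℝ X)
    (hQ : Q ∈ stdSimplex ℝ Y) (N : ℕ) : fidelityD P Q N ≤ fidelityM P Q N := by
  refine Real.sSup_le ?_ (fidelityM_nonneg _ _ _)
  rintro f ⟨W, W', rfl⟩
  refine le_csSup ⟨1, ?_⟩ ?_
  · rintro f ⟨_, _, _, h, _, _, rfl⟩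
    exact fidelity_le_one h hQ
  · have hW := pushforward_mem_stdSimplex W hP
    rw [pushforward_comp]
    exact ⟨_, hW, _, pushforward_mem_stdSimplex W' hW, majorized_pushforward W hP.1,
      majorized_pushforward W' hW.1, rfl⟩

/-- The alternatives in `hs` are the two bottlenecks, concentration of P and size of the storage.
Either one yields a set of at most K points with mass at least 1 - ε under the final distribution.
In the second, s is irrelevant. -/
lemma fidelityM_le {P : X → ℝ} {Q : Y → ℝ} {N : ℕ} (hP : P ∈ stdSimplex ℝ X)
    (hQ : Q ∈ stdSimplex ℝ Y) {K ε η : ℝ} {s : Finset X}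
    (hs : (s.card : ℝ) ≤ K ∧ 1 - ε ≤ ∑ x ∈ s, P x ∨ (2 : ℝ) ^ N ≤ K ∧ 0 ≤ ε)
    (hη : ∀ b : Finset Y, (b.card : ℝ) ≤ K → ∑ y ∈ b, Q y ≤ η) :
    fidelityM P Q N ≤ √η + √ε := by
  refine Real.sSup_le ?_ (by positivity)
  rintro f ⟨A, hA, B, hB, hPA, hAB, rfl⟩
  obtain ⟨b, hb, hsum⟩ : ∃ b : Finset Y, (b.card : ℝ) ≤ K ∧ 1 - ε ≤ ∑ y ∈ b, B y := by
    rcases hs with ⟨hK, hε⟩ | ⟨hK, hε⟩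
    · obtain ⟨b, hb, hsum⟩ := (hPA.trans hAB).exists_sum_le hP.1 s
      exact ⟨b, le_trans (by exact_mod_cast hb) hK, hε.trans hsum⟩
    · obtain ⟨b, hb, hsum⟩ := hAB.exists_sum_le hA.1 Finset.univ
      rw [hA.2] at hsum
      refine ⟨b, le_trans ?_ hK, by linarith⟩
      have : b.card ≤ 2 ^ N := by simpa using hb
      exact_mod_cast this
  refine (fidelity_le_sqrt_add_sqrt hB hQ b).trans (add_le_add ?_ ?_)
  · exact Real.sqrt_le_sqrt (hη b hb)
  · exact Real.sqrt_le_sqrt (by linarith)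

lemma fidelity_le_fidelityD_of_forall_mem {P : X → ℝ} {Q : Y → ℝ} (hP : P ∈ stdSimplex ℝ X)
    (hQ : Q ∈ stdSimplex ℝ Y) {N : ℕ} {t : Finset Y} (ht : t.card ≤ 2 ^ N) (f : X → Y)
    (hf : ∀ x, f x ∈ t) : fidelity (pushforward f P) Q ≤ fidelityD P Q N := by
  obtain ⟨e⟩ : Nonempty (t ↪ Storage N) := Function.Embedding.nonempty_of_card_le (by simpa using ht)
  have : Nonempty X := by
    by_contra h
    rw [not_nonempty_iff] at h
    simpa using hP.2
  have : Nonempty t := ⟨⟨_, hf (Classical.arbitrary X)⟩⟩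
  refine le_csSup (bddAbove_fidelityD hP hQ N)
    ⟨fun x => e ⟨f x, hf x⟩, fun z => (Function.invFun e z : t).1, ?_⟩
  congr 2
  ext x
  simp [Function.leftInverse_invFun e.injective _]

/-- The two terms of the minimum match the two outcomes of `exists_greedy_allocation`: all atoms of
s fit below Q, or each point of t misses its target by at most m. -/
lemma min_le_fidelityD {P : X → ℝ} {Q : Y → ℝ} (hP : P ∈ stdSimplex ℝ X)
    (hQ : Q ∈ stdSimplex ℝ Y) {N : ℕ} {t : Finset Y} (ht : t.card ≤ 2 ^ N) {m : ℝ}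
    (s : Finset X) (hs : ∀ x ∈ s, P x ≤ m) :
    min (∑ x ∈ s, P x) (∑ y ∈ t, Q y - t.card * m) ≤ fidelityD P Q N := by
  classical
  rcases t.eq_empty_or_nonempty with rfl | hne
  · exact (min_le_right _ _).trans (by simpa using fidelityD_nonneg P Q N)
  obtain ⟨f, hft, hf⟩ := exists_greedy_allocation hP.1 hQ.1 hne s hs
  refine le_trans ?_ (fidelity_le_fidelityD_of_forall_mem hP hQ ht f hft)
  refine le_trans ?_ (sum_min_le_fidelity (pushforward_nonneg f hP.1) hQ.1 t)
  have hR : ∀ y, ∑ x ∈ s with f x = y, P x ≤ pushforward f P y := fun y => by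
    unfold pushforward
    refine Finset.sum_le_sum_of_subset_of_nonneg (fun x => ?_) fun x _ _ => hP.1 x
    simp
  rcases hf with hf | hf
  · refine (min_le_left _ _).trans ?_
    rw [← Finset.sum_fiberwise_of_maps_to (t := t) (g := f) fun x _ => hft x]
    exact Finset.sum_le_sum fun y hy => le_min (hR y) (hf y hy)
  · refine (min_le_right _ _).trans ?_
    rw [← nsmul_eq_mul, ← Finset.sum_const, ← Finset.sum_sub_distrib]
    obtain hm | hm := le_or_gt 0 m
    · exact Finset.sum_le_sum fun y hy => le_min ((hf y hy).trans (hR y)) (by linarith)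
    -- For negative m no atom can satisfy `hs`, and an empty s contradicts the lower bound `hf`.
    · have hs0 : s = ∅ := Finset.eq_empty_of_forall_notMem fun x hx =>
        absurd (hs x hx) (by have := hP.1 x; linarith)
      subst hs0
      exact absurd (hf _ hne.choose_spec) (by
        have := hQ.1 hne.choose
        simp only [Finset.filter_empty, Finset.sum_empty]; linarith)

end Fidelity

/-! ### Concentration of the information content of i.i.d. distributions. -/

section Iid

variable {X : Type*}

/-- The information content `-log₂ P(x)`. -/
def surprisal (P : X → ℝ) (x : X) : ℝ := -Real.logb 2 (P x)

lemma iid_nonneg {P : X → ℝ} (hP : ∀ x, 0 ≤ P x) {n : ℕ} (x : Fin n → X) : 0 ≤ iid P n x :=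
  Finset.prod_nonneg fun i _ => hP (x i)

lemma iid_eq_rpow {P : X → ℝ} (hP : ∀ x, 0 ≤ P x) {n : ℕ} {x : Fin n → X} (hx : iid P n x ≠ 0) :
    iid P n x = (2 : ℝ) ^ (-∑ i, surprisal P (x i)) := by
  have hpos : ∀ i, 0 < P (x i) := fun i =>
    lt_of_le_of_ne (hP _) (Finset.prod_ne_zero_iff.mp hx i (Finset.mem_univ i)).symm
  rw [← Finset.sum_neg_distrib, Real.rpow_sum_of_pos two_pos]
  refine Finset.prod_congr rfl fun i _ => ?_
  rw [surprisal, neg_neg, Real.rpow_logb two_pos (by norm_num) (hpos i)]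

variable [Fintype X]

/-- The variance of the information content. -/
def varentropy (P : X → ℝ) : ℝ := ∑ x, P x * (surprisal P x - entropy P) ^ 2

lemma varentropy_nonneg {P : X → ℝ} (hP : ∀ x, 0 ≤ P x) : 0 ≤ varentropy P :=
  Finset.sum_nonneg fun x _ => mul_nonneg (hP x) (sq_nonneg _)

lemma sum_iid_succ_mul (P : X → ℝ) (n : ℕ) (φ : (Fin (n + 1) → X) → ℝ) :
    ∑ x, iid P (n + 1) x * φ x
      = ∑ a, P a * ∑ x : Fin n → X, iid P n x * φ (Fin.cons a x : Fin (n + 1) → X) := by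
  rw [← (Fin.consEquiv fun _ : Fin (n + 1) => X).sum_comp, Fintype.sum_prod_type]
  refine Finset.sum_congr rfl fun a _ => ?_
  rw [Finset.mul_sum]
  refine Finset.sum_congr rfl fun x _ => ?_
  simp [iid, Fin.prod_univ_succ, Fin.consEquiv, mul_assoc]

lemma sum_iid {P : X → ℝ} (hP : ∑ x, P x = 1) (n : ℕ) : ∑ x, iid P n x = 1 := by
  induction n with
  | zero => simp [iid]
  | succ n ih => simpa [ih, hP] using sum_iid_succ_mul P n fun _ => 1

lemma iid_mem_stdSimplex {P : X → ℝ} (hP : P ∈ stdSimplex ℝ X) (n : ℕ) :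
    iid P n ∈ stdSimplex ℝ (Fin n → X) :=
  ⟨iid_nonneg hP.1, sum_iid hP.2 n⟩

lemma sum_iid_mul_sum {P g : X → ℝ} (hP : ∑ x, P x = 1) (hg : ∑ x, P x * g x = 0) (n : ℕ) :
    ∑ x, iid P n x * ∑ i, g (x i) = 0 := by
  induction n with
  | zero => simp
  | succ n ih =>
    rw [sum_iid_succ_mul]
    simp only [Fin.sum_univ_succ, Fin.cons_zero, Fin.cons_succ, mul_add, Finset.sum_add_distrib,
      ih, add_zero, ← Finset.sum_mul, sum_iid hP, one_mul, hg]

/-- Additivity of variance: in the induction the cross term vanishes because g is centred. -/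
lemma sum_iid_mul_sum_sq {P g : X → ℝ} (hP : ∑ x, P x = 1) (hg : ∑ x, P x * g x = 0) (n : ℕ) :
    ∑ x, iid P n x * (∑ i, g (x i)) ^ 2 = n * ∑ x, P x * g x ^ 2 := by
  induction n with
  | zero => simp
  | succ n ih =>
    rw [sum_iid_succ_mul]
    have hinner : ∀ a, ∑ x : Fin n → X, iid P n x *
        (∑ i, g ((Fin.cons a x : Fin (n + 1) → X) i)) ^ 2
        = g a ^ 2 + n * ∑ x, P x * g x ^ 2 := fun a => by
      have : ∀ x : Fin n → X, iid P n x * (∑ i, g ((Fin.cons a x : Fin (n + 1) → X) i)) ^ 2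
          = iid P n x * g a ^ 2 + 2 * g a * (iid P n x * ∑ i, g (x i))
            + iid P n x * (∑ i, g (x i)) ^ 2 := fun x => by
        rw [Fin.sum_univ_succ]
        simp only [Fin.cons_zero, Fin.cons_succ]
        ring
      simp only [this, Finset.sum_add_distrib, ← Finset.sum_mul, ← Finset.mul_sum, ih,
        sum_iid hP, sum_iid_mul_sum hP hg]
      ring
    simp only [hinner, mul_add, Finset.sum_add_distrib, ← Finset.sum_mul, hP]
    push_cast
    ring

lemma sum_mul_surprisal_sub_entropy {P : X → ℝ} (hP : ∑ x, P x = 1) :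
    ∑ x, P x * (surprisal P x - entropy P) = 0 := by
  simp only [mul_sub, Finset.sum_sub_distrib, ← Finset.sum_mul, hP, one_mul]
  simp [entropy, surprisal]

/-- Chebyshev's inequality. Null sequences are exempted in `hs` because `logb 2 0 = 0` gives null
letters the meaningless surprisal 0. -/
lemma sum_iid_le_of_deviation {P : X → ℝ} (hP : P ∈ stdSimplex ℝ X) {n : ℕ} {a : ℝ} (ha : 0 < a)
    (s : Finset (Fin n → X))
    (hs : ∀ x ∈ s, iid P n x ≠ 0 → a ≤ |∑ i, surprisal P (x i) - n * entropy P|) :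
    ∑ x ∈ s, iid P n x ≤ n * varentropy P / a ^ 2 := by
  rw [le_div_iff₀ (by positivity), varentropy,
    ← sum_iid_mul_sum_sq hP.2 (sum_mul_surprisal_sub_entropy hP.2), Finset.sum_mul]
  refine le_trans (Finset.sum_le_sum fun x hx => ?_)
    (Finset.sum_le_univ_sum_of_nonneg fun x => mul_nonneg (iid_nonneg hP.1 x) (sq_nonneg _))
  by_cases h0 : iid P n x = 0
  · simp [h0]
  · refine mul_le_mul_of_nonneg_left ?_ (iid_nonneg hP.1 x)
    have := hs x hx h0
    rw [Finset.sum_sub_distrib, Finset.sum_const, Finset.card_univ, Fintype.card_fin, nsmul_eq_mul,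
      ← sq_abs (_ - _)]
    gcongr

lemma sum_iid_large_le {P : X → ℝ} (hP : P ∈ stdSimplex ℝ X) {n : ℕ} {a c : ℝ} (ha : 0 < a)
    (hc : c + a ≤ n * entropy P) :
    ∑ x with (2 : ℝ) ^ (-c) < iid P n x, iid P n x ≤ n * varentropy P / a ^ 2 := by
  refine sum_iid_le_of_deviation hP ha _ fun x hx h0 => ?_
  have h := (Finset.mem_filter.mp hx).2
  rw [iid_eq_rpow hP.1 h0, Real.rpow_lt_rpow_left_iff one_lt_two] at h
  rw [le_abs]
  right; linarith

lemma sum_iid_small_le {P : X → ℝ} (hP : P ∈ stdSimplex ℝ X) {n : ℕ} {a c : ℝ} (ha : 0 < a)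
    (hc : n * entropy P + a ≤ c) :
    ∑ x with iid P n x < (2 : ℝ) ^ (-c), iid P n x ≤ n * varentropy P / a ^ 2 := by
  refine sum_iid_le_of_deviation hP ha _ fun x hx h0 => ?_
  have h := (Finset.mem_filter.mp hx).2
  rw [iid_eq_rpow hP.1 h0, Real.rpow_lt_rpow_left_iff one_lt_two] at h
  rw [le_abs]
  left; linarith

lemma le_sum_iid_not_large {P : X → ℝ} (hP : P ∈ stdSimplex ℝ X) {n : ℕ} {a c : ℝ} (ha : 0 < a)
    (hc : c + a ≤ n * entropy P) :
    1 - n * varentropy P / a ^ 2 ≤ ∑ x with iid P n x ≤ (2 : ℝ) ^ (-c), iid P n x := by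
  have h := Finset.sum_filter_add_sum_filter_not Finset.univ
    (fun x : Fin n → X => (2 : ℝ) ^ (-c) < iid P n x) (iid P n)
  simp only [not_lt] at h
  rw [sum_iid hP.2] at h
  linarith [sum_iid_large_le hP ha hc]

lemma le_sum_iid_not_small {P : X → ℝ} (hP : P ∈ stdSimplex ℝ X) {n : ℕ} {a c : ℝ} (ha : 0 < a)
    (hc : n * entropy P + a ≤ c) :
    1 - n * varentropy P / a ^ 2 ≤ ∑ x with (2 : ℝ) ^ (-c) ≤ iid P n x, iid P n x := by
  have h := Finset.sum_filter_add_sum_filter_not Finset.univ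
    (fun x : Fin n → X => iid P n x < (2 : ℝ) ^ (-c)) (iid P n)
  simp only [not_lt] at h
  rw [sum_iid hP.2] at h
  linarith [sum_iid_small_le hP ha hc]

lemma card_filter_le_rpow {A : X → ℝ} (hA : A ∈ stdSimplex ℝ X) (c : ℝ) :
    ((Finset.univ.filter fun x => (2 : ℝ) ^ (-c) ≤ A x).card : ℝ) ≤ 2 ^ c := by
  have h : ((Finset.univ.filter fun x => (2 : ℝ) ^ (-c) ≤ A x).card : ℝ) * 2 ^ (-c) ≤ 1 := by
    rw [← nsmul_eq_mul, ← Finset.sum_const]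
    refine (Finset.sum_le_sum fun x hx => (Finset.mem_filter.mp hx).2).trans ?_
    exact (Finset.sum_le_univ_sum_of_nonneg hA.1).trans hA.2.le
  rwa [← le_div_iff₀ (by positivity), one_div, ← Real.rpow_neg two_pos.le, neg_neg] at h

/-- Atoms above 2^(-c) are atypically large and have small total mass; at most K others remain, each
at most 2^(-c). -/
lemma sum_iid_le_of_card_le {P : X → ℝ} (hP : P ∈ stdSimplex ℝ X) {n : ℕ} {a c K : ℝ}
    (ha : 0 < a) (hc : c + a ≤ n * entropy P) (b : Finset (Fin n → X)) (hb : (b.card : ℝ) ≤ K) :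
    ∑ x ∈ b, iid P n x ≤ n * varentropy P / a ^ 2 + K * 2 ^ (-c) := by
  rw [← Finset.sum_filter_add_sum_filter_not b (fun x => (2 : ℝ) ^ (-c) < iid P n x)]
  refine add_le_add (le_trans ?_ (sum_iid_large_le hP ha hc)) ?_
  · exact Finset.sum_le_sum_of_subset_of_nonneg
      (Finset.filter_subset_filter _ (Finset.subset_univ _)) fun x _ _ => iid_nonneg hP.1 x
  · refine (Finset.sum_le_card_nsmul _ _ _ fun x hx => not_lt.mp (Finset.mem_filter.mp hx).2).trans ?_
    rw [nsmul_eq_mul]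
    refine mul_le_mul_of_nonneg_right (le_trans ?_ hb) (by positivity)
    exact_mod_cast Finset.card_filter_le _ _

end Iid

/-! ### Asymptotics and the rate regions. -/

section Regions

lemma HasRate.eventually_abs_le {u : ℕ → ℕ} {r : ℝ} (h : HasRate u r) {c : ℝ} (hc : 0 < c) :
    ∀ᶠ n : ℕ in atTop, |(u n : ℝ) - r * n| ≤ c * n := by
  filter_upwards [h.def hc] with n hn
  simpa using hn

lemma tendsto_two_rpow_neg_atTop {ι : Type*} {l : Filter ι} {f : ι → ℝ} (hf : Tendsto f l atTop) :
    Tendsto (fun n => (2 : ℝ) ^ (-f n)) l (𝓝 0) := by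
  have h := (Real.tendsto_exp_neg_atTop_nhds_zero).comp (hf.const_mul_atTop (Real.log_pos one_lt_two))
  refine h.congr fun n => ?_
  rw [Real.rpow_def_of_pos two_pos, Function.comp_apply, mul_neg]

lemma isLittleO_rpow_three_quarters :
    (fun n : ℕ => (n : ℝ) ^ (3 / 4 : ℝ)) =o[atTop] fun n : ℕ => (n : ℝ) := by
  have h := (tendsto_rpow_neg_atTop (show (0 : ℝ) < 1 / 4 by norm_num)).comp
    (tendsto_natCast_atTop_atTop (R := ℝ))
  have hne : ∀ᶠ n : ℕ in atTop, 0 < (n : ℝ) :=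
    (eventually_gt_atTop 0).mono fun n hn => by exact_mod_cast hn
  refine (isLittleO_iff_tendsto' (hne.mono fun n hn h0 => absurd h0 hn.ne')).mpr (h.congr' ?_)
  filter_upwards [hne] with n hn
  rw [Function.comp_apply]
  nth_rw 3 [← Real.rpow_one (n : ℝ)]
  rw [← Real.rpow_sub hn]
  norm_num

lemma tendsto_natCast_div_rpow_three_quarters_sq :
    Tendsto (fun n : ℕ => (n : ℝ) / ((n : ℝ) ^ (3 / 4 : ℝ)) ^ 2) atTop (𝓝 0) := by
  have h := (tendsto_rpow_neg_atTop (show (0 : ℝ) < 1 / 2 by norm_num)).comp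
    (tendsto_natCast_atTop_atTop (R := ℝ))
  refine h.congr' ?_
  filter_upwards [eventually_gt_atTop 0] with n hn
  have hn' : (0 : ℝ) < n := by exact_mod_cast hn
  rw [Function.comp_apply, ← Real.rpow_natCast, ← Real.rpow_mul hn'.le]
  nth_rw 2 [← Real.rpow_one (n : ℝ)]
  rw [← Real.rpow_sub hn']
  norm_num

variable {X Y : Type*} [Fintype X] [Fintype Y]

lemma tendsto_fidelityM_zero {P : X → ℝ} {Q : Y → ℝ} (hP : P ∈ stdSimplex ℝ X)
    (hQ : Q ∈ stdSimplex ℝ Y) (hQ_pos : 0 < entropy Q) {s t : ℝ} {S T : ℕ → ℕ}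
    (hS : HasRate S s) (hT : HasRate T t) (hst : min (entropy P) s < t * entropy Q) :
    Tendsto (fun n => fidelityM (iid P n) (iid Q (T n)) (S n)) atTop (𝓝 0) := by
  classical
  -- The gap is cut into four layers: sets have size at most 2^((m+δ)n), the atom threshold for Q is
  -- 2^(-(m+2δ)n), Chebyshev needs a further δn, and the last δn absorbs the o(n) in T.
  obtain ⟨δ, hδ, hgap⟩ : ∃ δ > 0, min (entropy P) s + 4 * δ = t * entropy Q :=
    ⟨(t * entropy Q - min (entropy P) s) / 4, by linarith, by ring⟩
  set m := min (entropy P) s with hm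
  have hVQ := varentropy_nonneg hQ.1
  have hδn : Tendsto (fun n : ℕ => δ * (n : ℝ)) atTop atTop :=
    tendsto_natCast_atTop_atTop.const_mul_atTop hδ
  have hη : Tendsto (fun n : ℕ => √((t + 1) * varentropy Q / δ ^ 2 / n + 2 ^ (-(δ * (n : ℝ))))
      + √(varentropy P / δ ^ 2 / n)) atTop (𝓝 0) := by
    have h1 := tendsto_const_div_atTop_nhds_zero_nat ((t + 1) * varentropy Q / δ ^ 2)
    have h2 := tendsto_const_div_atTop_nhds_zero_nat (varentropy P / δ ^ 2)
    simpa using ((h1.add (tendsto_two_rpow_neg_atTop hδn)).sqrt).add h2.sqrt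
  refine tendsto_of_tendsto_of_tendsto_of_le_of_le' tendsto_const_nhds hη
    (Eventually.of_forall fun n => fidelityM_nonneg _ _ _) ?_
  filter_upwards [hS.eventually_abs_le hδ, hT.eventually_abs_le one_pos,
    hT.eventually_abs_le (div_pos hδ hQ_pos), eventually_gt_atTop 0] with n hSn hTn hTn' hn
  have hn' : (0 : ℝ) < n := by exact_mod_cast hn
  have ha : 0 < δ * n := by positivity
  have hTQ : (m + 3 * δ) * n ≤ T n * entropy Q := by
    have h := mul_le_mul_of_nonneg_right (abs_le.mp hTn').1 hQ_pos.le
    have h2 : δ / entropy Q * n * entropy Q = δ * n := by field_simp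
    nlinarith
  refine fidelityM_le (iid_mem_stdSimplex hP n) (iid_mem_stdSimplex hQ _)
    (K := 2 ^ ((m + δ) * n))
    (s := Finset.univ.filter fun x => (2 : ℝ) ^ (-((m + δ) * n)) ≤ iid P n x) ?_ fun b hb => ?_
  · rcases le_total (entropy P) s with h | h
    · rw [min_eq_left h] at hm
      refine Or.inl ⟨card_filter_le_rpow (iid_mem_stdSimplex hP n) _, ?_⟩
      refine le_trans (le_of_eq ?_) (le_sum_iid_not_small hP ha (by rw [hm]; linarith))
      field_simp
    · rw [min_eq_right h] at hm
      refine Or.inr ⟨?_, by have := varentropy_nonneg hP.1; positivity⟩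
      rw [← Real.rpow_natCast]
      refine Real.rpow_le_rpow_of_exponent_le one_le_two ?_
      have := (abs_le.mp hSn).2
      rw [hm]; linarith
  · refine (sum_iid_le_of_card_le hQ ha (c := (m + 2 * δ) * n) (by linarith) b hb).trans
      (add_le_add ?_ (le_of_eq ?_))
    · have h : (T n : ℝ) ≤ (t + 1) * n := by linarith [(abs_le.mp hTn).2]
      calc (T n : ℝ) * varentropy Q / (δ * n) ^ 2
          ≤ (t + 1) * n * varentropy Q / (δ * n) ^ 2 := by gcongr
        _ = (t + 1) * varentropy Q / δ ^ 2 / n := by field_simp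
    · rw [← Real.rpow_add two_pos]
      congr 1
      ring

lemma exists_rates_tendsto_fidelityD_one {P : X → ℝ} {Q : Y → ℝ} (hP : P ∈ stdSimplex ℝ X)
    (hQ : Q ∈ stdSimplex ℝ Y) (hQ_pos : 0 < entropy Q) {s t : ℝ} (hs : 0 < s) (ht : 0 < t)
    (htP : t * entropy Q ≤ entropy P) (hts : t * entropy Q ≤ s) :
    ∃ S T : ℕ → ℕ, HasRate S s ∧ HasRate T t ∧
      Tendsto (fun n => fidelityD (iid P n) (iid Q (T n)) (S n)) atTop (𝓝 1) := by
  classical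
  -- The exponent 3/4 lies strictly between 1/2 and 1: n/a² → 0 kills the Chebyshev errors, while a
  -- = o(n) leaves the rates unchanged.
  set a : ℕ → ℝ := fun n => (n : ℝ) ^ (3 / 4 : ℝ) with ha_def
  have ha_nonneg : ∀ n, 0 ≤ a n := fun n => by positivity
  have ha_atTop : Tendsto a atTop atTop :=
    (tendsto_rpow_atTop (by norm_num)).comp tendsto_natCast_atTop_atTop
  have hone : (fun _ : ℕ => (1 : ℝ)) =o[atTop] fun n : ℕ => (n : ℝ) :=
    isLittleO_const_left.mpr (Or.inr (tendsto_norm_atTop_atTop.comp tendsto_natCast_atTop_atTop))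
  have hao : (fun n => 3 / entropy Q * a n) =o[atTop] fun n : ℕ => (n : ℝ) :=
    isLittleO_rpow_three_quarters.const_mul_left _
  have hpos : ∀ᶠ n : ℕ in atTop, 0 ≤ t * n - 3 / entropy Q * a n := by
    filter_upwards [hao.def ht] with n hn
    have := (le_abs_self _).trans hn
    simp only [Real.norm_natCast] at this
    linarith
  -- Lowering T by 3a/H(Q) lowers its total entropy by 3a: one a for the typicality margin of P, one
  -- for that of Q, and one that makes |t|·m at most 2^(-a) below. This covers the boundary case of
  -- equality.
  refine ⟨fun n => ⌈s * n⌉₊, fun n => ⌊t * n - 3 / entropy Q * a n⌋₊, ?_, ?_, ?_⟩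
  · refine IsBigO.trans_isLittleO (IsBigO.of_bound 1 (Eventually.of_forall fun n => ?_)) hone
    have h1 := Nat.le_ceil (s * n)
    have h2 := Nat.ceil_lt_add_one (show 0 ≤ s * n by positivity)
    rw [Real.norm_eq_abs, norm_one, abs_le]
    constructor <;> linarith
  · refine IsBigO.trans_isLittleO (IsBigO.of_bound 1 ?_) (hao.add hone)
    filter_upwards [hpos] with n hn
    have h1 := Nat.floor_le hn
    have h2 := Nat.lt_floor_add_one (t * n - 3 / entropy Q * a n)
    have h3 : 0 ≤ 3 / entropy Q * a n := mul_nonneg (by positivity) (ha_nonneg n)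
    rw [Real.norm_eq_abs, Real.norm_eq_abs, one_mul, abs_of_nonneg (by linarith : 0 ≤ _ + (1 : ℝ)),
      abs_le]
    constructor <;> linarith
  have hlow : Tendsto (fun n : ℕ => min (1 - varentropy P * (n / a n ^ 2))
      (1 - t * varentropy Q * (n / a n ^ 2) - 2 ^ (-a n))) atTop (𝓝 1) := by
    have h0 : Tendsto (fun n : ℕ => (n : ℝ) / a n ^ 2) atTop (𝓝 0) :=
      tendsto_natCast_div_rpow_three_quarters_sq
    have h1 := (h0.const_mul (varentropy P)).const_sub 1
    have h2 := ((h0.const_mul (t * varentropy Q)).const_sub 1).sub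
      (tendsto_two_rpow_neg_atTop ha_atTop)
    simpa using h1.min h2
  refine tendsto_of_tendsto_of_tendsto_of_le_of_le' hlow tendsto_const_nhds ?_
    (Eventually.of_forall fun n =>
      (fidelityD_le_fidelityM (iid_mem_stdSimplex hP n) (iid_mem_stdSimplex hQ _) _).trans
        (fidelityM_le_one _ (iid_mem_stdSimplex hQ _) _))
  filter_upwards [hpos, ha_atTop.eventually_gt_atTop 0] with n hn ha
  set T := ⌊t * n - 3 / entropy Q * a n⌋₊ with hT
  have hTle : (T : ℝ) ≤ t * n - 3 / entropy Q * a n := Nat.floor_le hn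
  have hTt : (T : ℝ) ≤ t * n := by
    have : 0 ≤ 3 / entropy Q * a n := by positivity
    linarith
  have hTQ : T * entropy Q ≤ t * entropy Q * n - 3 * a n := by
    have h := mul_le_mul_of_nonneg_right hTle hQ_pos.le
    have h2 : 3 / entropy Q * a n * entropy Q = 3 * a n := by field_simp
    linarith
  have hTP := mul_le_mul_of_nonneg_right htP n.cast_nonneg
  have hTs := mul_le_mul_of_nonneg_right hts n.cast_nonneg
  have hcard := card_filter_le_rpow (iid_mem_stdSimplex hQ T) (T * entropy Q + a n)
  refine le_trans ?_ (min_le_fidelityD (iid_mem_stdSimplex hP n) (iid_mem_stdSimplex hQ T)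
    (t := Finset.univ.filter fun y => (2 : ℝ) ^ (-(T * entropy Q + a n)) ≤ iid Q T y)
    (m := 2 ^ (-(n * entropy P - a n)))
    ?_ (Finset.univ.filter fun x => iid P n x ≤ (2 : ℝ) ^ (-(n * entropy P - a n)))
    fun x hx => (Finset.mem_filter.mp hx).2)
  · refine min_le_min ?_ (sub_le_sub ?_ ?_)
    · refine le_trans (le_of_eq ?_) (le_sum_iid_not_large hP ha (by linarith))
      ring
    · refine le_trans ?_ (le_sum_iid_not_small hQ ha le_rfl)
      have hV := varentropy_nonneg hQ.1
      have : T * varentropy Q / a n ^ 2 ≤ t * n * varentropy Q / a n ^ 2 := by gcongr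
      have h2 : t * n * varentropy Q / a n ^ 2 = t * varentropy Q * (n / a n ^ 2) := by ring
      linarith
    · refine (mul_le_mul_of_nonneg_right hcard (by positivity)).trans ?_
      rw [← Real.rpow_add two_pos]
      exact Real.rpow_le_rpow_of_exponent_le one_le_two (by linarith)
  · have h : ((2 : ℝ) ^ (T * entropy Q + a n)) ≤ (2 : ℝ) ^ ⌈s * n⌉₊ := by
      rw [← Real.rpow_natCast]
      exact Real.rpow_le_rpow_of_exponent_le one_le_two (by linarith [Nat.le_ceil (s * n)])
    exact_mod_cast hcard.trans h

lemma regionD_subset_regionM {P : X → ℝ} {Q : Y → ℝ} (hP : P ∈ stdSimplex ℝ X)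
    (hQ : Q ∈ stdSimplex ℝ Y) (ν : ℝ) : regionD P Q ν ⊆ regionM P Q ν := by
  rintro r ⟨h1, h2, S, T, hS, hT, h⟩
  refine ⟨h1, h2, S, T, hS, hT, h.trans (liminf_le_liminf (Eventually.of_forall fun n =>
    fidelityD_le_fidelityM (iid_mem_stdSimplex hP n) (iid_mem_stdSimplex hQ _) _) ?_ ?_)⟩
  · exact isBoundedUnder_of ⟨0, fun n => fidelityD_nonneg _ _ _⟩
  · exact (isBoundedUnder_of
      ⟨1, fun n => fidelityM_le_one _ (iid_mem_stdSimplex hQ _) _⟩).isCoboundedUnder_ge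

lemma le_min_div_of_mem_regionM {P : X → ℝ} {Q : Y → ℝ} (hP : P ∈ stdSimplex ℝ X)
    (hQ : Q ∈ stdSimplex ℝ Y) (hQ_pos : 0 < entropy Q) {ν : ℝ} (hν : 0 < ν) {r : ℝ × ℝ}
    (hr : r ∈ regionM P Q ν) : r.2 ≤ min (entropy P) r.1 / entropy Q := by
  obtain ⟨-, -, S, T, hS, hT, h⟩ := hr
  rw [le_div_iff₀ hQ_pos]
  by_contra! hlt
  have h0 := (tendsto_fidelityM_zero hP hQ hQ_pos hS hT hlt).liminf_eq
  exact absurd (h.trans h0.le) (not_le.mpr hν)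

lemma mem_regionD {P : X → ℝ} {Q : Y → ℝ} (hP : P ∈ stdSimplex ℝ X) (hQ : Q ∈ stdSimplex ℝ Y)
    (hQ_pos : 0 < entropy Q) {ν : ℝ} (hν : ν ≤ 1) {r : ℝ × ℝ} (h1 : 0 < r.1) (h2 : 0 < r.2)
    (hr : r.2 ≤ min (entropy P) r.1 / entropy Q) : r ∈ regionD P Q ν := by
  rw [le_div_iff₀ hQ_pos, le_min_iff] at hr
  obtain ⟨S, T, hS, hT, h⟩ := exists_rates_tendsto_fidelityD_one hP hQ hQ_pos h1 h2 hr.1 hr.2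
  exact ⟨h1, h2, S, T, hS, hT, hν.trans h.liminf_eq.ge⟩

end Regions

end RNC

end

theorem theorem1 {X Y : Type*} [Fintype X] [Fintype Y] (P : X → ℝ) (Q : Y → ℝ)
    (hP : P ∈ stdSimplex ℝ X) (hQ : Q ∈ stdSimplex ℝ Y) (hQ_pos : 0 < RNC.entropy Q)
    (ν : ℝ) (hν : ν ∈ Set.Ioo (0 : ℝ) 1) :
    RNC.regionD P Q ν = RNC.regionM P Q ν ∧
      RNC.regionM P Q ν =
        {r : ℝ × ℝ | 0 < r.1 ∧ 0 < r.2 ∧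
          r.2 ≤ min (RNC.entropy P) r.1 / RNC.entropy Q} := by
  have hDM := RNC.regionD_subset_regionM hP hQ ν
  have hM : ∀ r ∈ RNC.regionM P Q ν, 0 < r.1 ∧ 0 < r.2 ∧
      r.2 ≤ min (RNC.entropy P) r.1 / RNC.entropy Q := fun r hr =>
    ⟨hr.1, hr.2.1, RNC.le_min_div_of_mem_regionM hP hQ hQ_pos hν.1 hr⟩
  have hD : ∀ r : ℝ × ℝ, 0 < r.1 ∧ 0 < r.2 ∧
      r.2 ≤ min (RNC.entropy P) r.1 / RNC.entropy Q → r ∈ RNC.regionD P Q ν := fun r hr =>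
    RNC.mem_regionD hP hQ hQ_pos hν.2.le hr.1 hr.2.1 hr.2.2
  exact ⟨hDM.antisymm fun r hr => hD r (hM r hr),
    Set.Subset.antisymm hM fun r hr => hDM (hD r hr)⟩
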